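/- A configuration system with parameter $b\in\mathbb N$ consists of a universe $\mathbb U$, a finite family $S$ of $n=|S|$ objects (subsets of $\mathbb U$), a finite family of configurations $c=(y,B_y)$, each given by a region $y\subseteq\mathbb U$ and a set $B_y\subseteq S$ of at most $b$ objects defining it, and a conflict relation between objects and configurations such that $s$ conflicts with $(y,B_y)$ whenever $s\cap y\neq\emptyset$ (further conflicts are allowed). For $H\subseteq S$, a $j$-region of $H$ is a configuration $(y,B_y)$ with $B_y\subseteq H$ that conflicts with exactly $j$ objects of $H$; $\mathcal F_0(H)$ is the set of $0$-regions of $H$. The system is complete if, for every $R\subseteq S$, each point of $\mathbb U\setminus\bigcup R$ lies in the region of some $0$-region of $R$. An $\epsilon$-net for $T\subseteq S$ is a set $N\subseteq T$ such that every point of $\mathbb U$ contained in at least $\epsilon|T|$ objects of $T$ is contained in some object of $N$. For an integer $q\ge 2$ and a constant $K$, a likely $1/q$-net for $T\subseteq S$ is a set $R\subseteq T$ with $|R|\le Kq\log q$ such that every $0$-region of $R$ is a $j$-region of $T$ for some $j\le |T|/q$. **Theorem.** For every $b\in\mathbb N$ and $K\in\mathbb R$ there is a constant $C>0$, depending only on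 $b$ and $K$, such that the following holds. Take any complete configuration system with parameter $b$ such that, for every subset $T\subseteq S$ and every integer $q\ge 2$, a likely $1/q$-net for $T$ with constant $K$ exists. Let $f(r):=E|\mathcal F_0(R)|$, where $R\subseteq S$ is a uniformly random subset of size $r$. Then for every integer $r$ with $1\le r\le |S|$ and $r\ge 2b$, there is a $1/r$-net for $S$ of size at most $C\max(r,f(r))$. In particular, if $f(r)\ge r$, there is a $1/r$-net for $S$ of size at most $C f(r)$. -/

import Mathlib

/-- A configuration system with parameter `b`: a universe `U`, a finite family `S` of objects
(subsets of `U`, indexed by `ι`), and a finite family of configurations, indexed by `κ`.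
A configuration `c` is a pair of a region `region c ⊆ U` and a set `definers c` of at most `b`
objects defining it. An object that meets the region of `c` conflicts with `c`; there may be
further conflicts (for instance from tie-breaking). -/
structure ConfigurationSystem (U ι κ : Type*) (b : ℕ) where
  obj : ι → Set U
  region : κ → Set U
  definers : κ → Finset ι
  card_definers_le : ∀ c, (definers c).card ≤ b
  Conflicts : ι → κ → Prop
  conflicts_of_meets : ∀ s c, (obj s ∩ region c).Nonempty → Conflicts s c

namespace ConfigurationSystem

variable {U ι κ : Type*} {b : ℕ}

/-- The union of the objects in `H`. -/
def cover (D : ConfigurationSystem U ι κ b) (H : Finset ι) : Set U :=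
  ⋃ s ∈ H, D.obj s

open Classical in
/-- The number of objects in `H` that conflict with the configuration `c`. -/
noncomputable def conflictCount (D : ConfigurationSystem U ι κ b) (H : Finset ι) (c : κ) : ℕ :=
  (H.filter fun s => D.Conflicts s c).card

open Classical in
/-- The `j`-regions of `H`: the configurations that are defined by objects of `H` and conflict
with exactly `j` objects of `H`. -/
noncomputable def regions [Fintype κ] (D : ConfigurationSystem U ι κ b) (j : ℕ) (H : Finset ι) :
    Finset κ :=
  Finset.univ.filter fun c => D.definers c ⊆ H ∧ D.conflictCount H c = j

/-- The system is complete if, for every set `R` of objects, each point that is in no object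
of `R` is in some `0`-region of `R`. -/
def IsComplete [Fintype κ] (D : ConfigurationSystem U ι κ b) : Prop :=
  ∀ R : Finset ι, ∀ p : U, p ∉ D.cover R → ∃ c ∈ D.regions 0 R, p ∈ D.region c

open Classical in
/-- The number of objects in `T` that contain the point `p`. -/
noncomputable def depth (D : ConfigurationSystem U ι κ b) (T : Finset ι) (p : U) : ℕ :=
  (T.filter fun s => p ∈ D.obj s).card

/-- `N` is an `ε`-net for the objects `T`: it is a subset of `T` that covers all points
contained in at least `ε |T|` objects of `T`. -/
def IsNet (D : ConfigurationSystem U ι κ b) (ε : ℝ) (T N : Finset ι) : Prop :=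
  N ⊆ T ∧ ∀ p : U, ε * (T.card : ℝ) ≤ (D.depth T p : ℝ) → p ∈ D.cover N

/-- `R` is a likely `1/q`-net for the objects `T`, with constant `K`: it is a subset of `T` of
size at most `K q log q`, and every `0`-region of `R` is a `j`-region of `T` for
some `j ≤ |T| / q`. -/
def IsLikelyNet [Fintype κ] (D : ConfigurationSystem U ι κ b) (K : ℝ) (q : ℕ)
    (T R : Finset ι) : Prop :=
  R ⊆ T ∧ (R.card : ℝ) ≤ K * q * Real.log q ∧
    ∀ c ∈ D.regions 0 R, ∃ j : ℕ, (j : ℝ) ≤ (T.card : ℝ) / q ∧ c ∈ D.regions j T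

/-- Likely `1/q`-nets with constant `K` exist for every subset of the objects and every
integer `q ≥ 2`. -/
def LikelyNetsExist [Fintype κ] (D : ConfigurationSystem U ι κ b) (K : ℝ) : Prop :=
  ∀ (T : Finset ι) (q : ℕ), 2 ≤ q → ∃ R : Finset ι, D.IsLikelyNet K q T R

/-- The expected number of `0`-regions of `R`, where `R` is a uniformly random set of exactly `r`
objects (meaningful for `r ≤ |S|`). -/
noncomputable def expectedZeroRegions [Fintype ι] [Fintype κ] (D : ConfigurationSystem U ι κ b)
    (r : ℕ) : ℝ :=
  (∑ R ∈ (Finset.univ : Finset ι).powersetCard r, ((D.regions 0 R).card : ℝ)) /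
    (((Finset.univ : Finset ι).powersetCard r).card : ℝ)

end ConfigurationSystem

/-!
Draw a random set `R` of `2r` objects. By completeness a point that `R` does not cover lies in the
region of some `0`-region `c` of `R`; all objects containing the point conflict with `c`, so if
`t · n / r` objects conflict with `c`, a likely `1/q`-net of these with `q ≈ t` covers every point
of the region that lies in at least `n / r` objects. This costs `O(q log q) = O(t²)` objects.

To see that the costs add up to `O(f(r))` in expectation, draw `R` as a random `r`-set `R'` together
with a random `r`-subset of the other objects. Being a `0`-region of `R` amounts, up to a factor
`O_b(1)`, to being a `0`-region of `R'` and then having no conflict among the `r` additional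
objects. The second event has conditional probability at most `e⁻ᵗ`, which outweighs the cost `t²`.
-/

open Finset
open scoped BigOperators

theorem choose_mul_le_choose_mul_mul_choose (a : ℕ) {d r : ℕ} (h : d ≤ r) :
    (a * r).choose d ≤ (a * d).choose d * r.choose d := by
  have hfactor : ∀ i ∈ range d, (a * r - i) * (d - i) ≤ (a * d - i) * (r - i) := by
    intro i hi
    rcases a with _ | a
    · simp only [zero_mul, Nat.zero_sub, le_refl]
    · obtain ⟨u, rfl⟩ := Nat.exists_eq_add_of_le (mem_range.1 hi).le
      obtain ⟨v, rfl⟩ := Nat.exists_eq_add_of_le h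
      rw [show (a + 1) * (i + u + v) - i = a * (i + u + v) + u + v by rw [add_one_mul]; omega,
        show (a + 1) * (i + u) - i = a * (i + u) + u by rw [add_one_mul]; omega,
        show i + u - i = u by omega, show i + u + v - i = u + v by omega]
      linarith [Nat.zero_le (a * i * v)]
  have hdesc : (a * r).descFactorial d * d.descFactorial d ≤
      (a * d).descFactorial d * r.descFactorial d := by
    simpa only [Nat.descFactorial_eq_prod_range, prod_mul_distrib] using prod_le_prod' hfactor
  simp only [Nat.descFactorial_eq_factorial_mul_choose, Nat.choose_self, mul_one] at hdesc
  refine Nat.le_of_mul_le_mul_left ?_ (mul_pos d.factorial_pos d.factorial_pos)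
  linarith

theorem choose_two_mul_le_centralBinom_mul {d r : ℕ} (h : d ≤ r) :
    (2 * r).choose r ≤ d.centralBinom * (2 * r - d).choose (r - d) := by
  refine Nat.le_of_mul_le_mul_right ?_ (Nat.choose_pos h)
  calc (2 * r).choose r * r.choose d
      = (2 * r).choose d * (2 * r - d).choose (r - d) := Nat.choose_mul h
    _ ≤ (2 * d).choose d * r.choose d * (2 * r - d).choose (r - d) := by
        gcongr
        exact choose_mul_le_choose_mul_mul_choose 2 h
    _ = d.centralBinom * (2 * r - d).choose (r - d) * r.choose d := by
        rw [Nat.centralBinom_eq_two_mul_choose, mul_right_comm]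

theorem choose_mul_pow_le_choose_mul_pow {x y : ℕ} (h : x ≤ y) (m : ℕ) :
    x.choose m * y ^ m ≤ y.choose m * x ^ m := by
  have hfactor : ∀ i ∈ range m, (x - i) * y ≤ (y - i) * x := by
    intro i _
    rw [Nat.sub_mul, Nat.sub_mul, mul_comm y x]
    exact Nat.sub_le_sub_left (Nat.mul_le_mul_left i h) _
  have hdesc : x.descFactorial m * y ^ m ≤ y.descFactorial m * x ^ m := by
    simpa only [Nat.descFactorial_eq_prod_range, prod_mul_distrib, prod_const, card_range]
      using prod_le_prod' hfactor
  simp only [Nat.descFactorial_eq_factorial_mul_choose, mul_assoc] at hdesc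
  exact Nat.le_of_mul_le_mul_left hdesc m.factorial_pos

theorem cast_sub_div_le_exp_neg_div {n : ℕ} (hn : 0 < n) (k : ℕ) :
    ((n - k : ℕ) : ℝ) / n ≤ Real.exp (-(k / n)) := by
  have hn' : (0 : ℝ) < n := by exact_mod_cast hn
  rcases le_total k n with hkn | hnk
  · rw [Nat.cast_sub hkn, sub_div, div_self hn'.ne']
    exact Real.one_sub_le_exp_neg _
  · rw [Nat.sub_eq_zero_of_le hnk, Nat.cast_zero, zero_div]
    exact (Real.exp_pos _).le

theorem choose_sub_div_choose_le_exp {n : ℕ} (hn : 0 < n) (k m : ℕ) :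
    ((n - k).choose m : ℝ) / n.choose m ≤ Real.exp (-(k * m / n)) := by
  have hnm : (0 : ℝ) < (n : ℝ) ^ m := pow_pos (by exact_mod_cast hn) m
  have hpow : ((n - k).choose m : ℝ) * n ^ m ≤ n.choose m * ((n - k : ℕ) : ℝ) ^ m := by
    exact_mod_cast choose_mul_pow_le_choose_mul_pow (n.sub_le k) m
  calc ((n - k).choose m : ℝ) / n.choose m
      ≤ (((n - k : ℕ) : ℝ) / n) ^ m := by
        refine div_le_of_le_mul₀ (by positivity) (by positivity) ?_
        rw [div_pow, div_mul_eq_mul_div, le_div_iff₀ hnm]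
        linarith
    _ ≤ Real.exp (-(k / n)) ^ m := by
        gcongr
        exact cast_sub_div_le_exp_neg_div hn k
    _ = Real.exp (-(k * m / n)) := by
        rw [← Real.exp_nat_mul]
        ring_nf

section Sampling

variable {α : Type*} [Fintype α] [DecidableEq α]

/-- The probability that a uniformly random `m`-element subset of `α` contains `B` and is disjoint
from `T`. It is `0` when `m` exceeds the cardinality of `α`, both counts then being `0`. -/
noncomputable def sampleProb (m : ℕ) (B T : Finset α) : ℝ :=
  #{R ∈ (univ : Finset α).powersetCard m | B ⊆ R ∧ Disjoint R T} / (Fintype.card α).choose m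

theorem sampleProb_nonneg (m : ℕ) (B T : Finset α) : 0 ≤ sampleProb m B T :=
  div_nonneg (Nat.cast_nonneg _) (Nat.cast_nonneg _)

theorem sampleProb_of_not_disjoint (m : ℕ) {B T : Finset α} (h : ¬ Disjoint B T) :
    sampleProb m B T = 0 := by
  have hempty : {R ∈ (univ : Finset α).powersetCard m | B ⊆ R ∧ Disjoint R T} = ∅ :=
    filter_eq_empty_iff.2 fun R _ hR => h (hR.2.mono_left hR.1)
  rw [sampleProb, hempty, card_empty, Nat.cast_zero, zero_div]

theorem sampleProb_of_disjoint {m : ℕ} {B T : Finset α} (h : Disjoint B T) (hm : #B ≤ m) :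
    sampleProb m B T = (Fintype.card α - #T - #B).choose (m - #B) / (Fintype.card α).choose m := by
  have hfilter : {R ∈ (univ : Finset α).powersetCard m | B ⊆ R ∧ Disjoint R T} =
      {R ∈ Tᶜ.powersetCard m | B ⊆ R} := by
    ext R
    simp only [mem_filter, mem_powersetCard, subset_univ, subset_compl_iff_disjoint_right]
    tauto
  rw [sampleProb, hfilter, card_filter_powersetCard_subset B Tᶜ m
    (subset_compl_iff_disjoint_right.2 h) hm, card_compl]

/-- Both sides are the probability that `B ⊆ R` and `Disjoint M T`, where `R` is a random
`r`-element subset of a random `m`-element set `M`: on the left `M` is drawn first, on the right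
`R` is. -/
theorem sampleProb_mul_choose_div (B T : Finset α) {r m : ℕ} (hB : #B ≤ r) (hrm : r ≤ m) :
    sampleProb m B T * ((m - #B).choose (r - #B) / m.choose r) =
      sampleProb r B T *
        ((Fintype.card α - r - #T).choose (m - r) / (Fintype.card α - r).choose (m - r)) := by
  by_cases hBT : Disjoint B T
  · rw [sampleProb_of_disjoint hBT hB, sampleProb_of_disjoint hBT (hB.trans hrm),
      div_mul_div_comm, div_mul_div_comm]
    congr 1
    · have hchoose := Nat.choose_mul (n := Fintype.card α - #T - #B) (Nat.sub_le_sub_right hrm #B)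
      rw [show Fintype.card α - #T - #B - (r - #B) = Fintype.card α - r - #T by omega,
        show m - #B - (r - #B) = m - r by omega] at hchoose
      exact_mod_cast hchoose
    · exact_mod_cast Nat.choose_mul hrm
  · simp only [sampleProb_of_not_disjoint _ hBT, zero_mul]

theorem sampleProb_two_mul_le (B T : Finset α) {r : ℕ} (hB : #B ≤ r) (hr : r < Fintype.card α) :
    sampleProb (2 * r) B T ≤
      (#B).centralBinom * (sampleProb r B T * Real.exp (-(#T * r / Fintype.card α))) := by
  have hcentral : (0 : ℝ) < (#B).centralBinom := by exact_mod_cast (#B).centralBinom_pos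
  have hcontain : 1 / (#B).centralBinom ≤
      ((2 * r - #B).choose (r - #B) : ℝ) / (2 * r).choose r := by
    have hpos : (0 : ℝ) < (2 * r).choose r := by
      exact_mod_cast Nat.choose_pos (Nat.le_mul_of_pos_left r two_pos)
    rw [div_le_div_iff₀ hcentral hpos, one_mul, mul_comm (Nat.cast _)]
    exact_mod_cast choose_two_mul_le_centralBinom_mul hB
  have havoid : ((Fintype.card α - r - #T).choose r : ℝ) / (Fintype.card α - r).choose r ≤
      Real.exp (-(#T * r / Fintype.card α)) := by
    refine (choose_sub_div_choose_le_exp (Nat.sub_pos_of_lt hr) #T r).trans ?_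
    have hpos : (0 : ℝ) < (Fintype.card α - r : ℕ) := by exact_mod_cast Nat.sub_pos_of_lt hr
    gcongr
    exact Nat.sub_le _ _
  have hidentity := sampleProb_mul_choose_div B T hB (Nat.le_mul_of_pos_left r two_pos)
  rw [show 2 * r - r = r by omega] at hidentity
  rw [← div_le_iff₀' hcentral, div_eq_mul_one_div]
  calc sampleProb (2 * r) B T * (1 / (#B).centralBinom)
      ≤ sampleProb (2 * r) B T * ((2 * r - #B).choose (r - #B) / (2 * r).choose r) :=
        mul_le_mul_of_nonneg_left hcontain (sampleProb_nonneg _ _ _)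
    _ = sampleProb r B T *
          ((Fintype.card α - r - #T).choose r / (Fintype.card α - r).choose r) := hidentity
    _ ≤ sampleProb r B T * Real.exp (-(#T * r / Fintype.card α)) :=
        mul_le_mul_of_nonneg_left havoid (sampleProb_nonneg _ _ _)

end Sampling

namespace ConfigurationSystem

variable {U ι κ : Type*} {b : ℕ}

open Classical in
/-- The objects of `H` that conflict with the configuration `c`, of which `conflictCount H c` is the
number. -/
noncomputable def conflictSet (D : ConfigurationSystem U ι κ b) (H : Finset ι) (c : κ) :
    Finset ι :=
  H.filter fun s => D.Conflicts s c

theorem depth_conflictSet (D : ConfigurationSystem U ι κ b) (T : Finset ι) {c : κ} {p : U}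
    (hp : p ∈ D.region c) : D.depth (D.conflictSet T c) p = D.depth T p := by
  classical
  rw [depth, conflictSet, filter_filter, depth]
  congr 1
  exact filter_congr fun s _ =>
    and_iff_right_of_imp fun hs => D.conflicts_of_meets s c ⟨p, hs, hp⟩

theorem depth_le_conflictCount (D : ConfigurationSystem U ι κ b) (T : Finset ι) {c : κ} {p : U}
    (hp : p ∈ D.region c) : D.depth T p ≤ D.conflictCount T c := by
  rw [← D.depth_conflictSet T hp]
  classical
  exact card_filter_le _ _

theorem cover_mono (D : ConfigurationSystem U ι κ b) {H H' : Finset ι} (h : H ⊆ H') :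
    D.cover H ⊆ D.cover H' :=
  Set.biUnion_subset_biUnion_left h

theorem isNet_self (D : ConfigurationSystem U ι κ b) {ε : ℝ} (hε : 0 < ε) {T : Finset ι}
    (hT : T.Nonempty) : D.IsNet ε T T := by
  classical
  refine ⟨Subset.rfl, fun p hp => ?_⟩
  have hdepth : 0 < D.depth T p := by
    have hcard : (0 : ℝ) < #T := by exact_mod_cast hT.card_pos
    exact_mod_cast (mul_pos hε hcard).trans_le hp
  obtain ⟨s, hs⟩ := card_pos.1 hdepth
  exact Set.mem_biUnion (mem_filter.1 hs).1 (mem_filter.1 hs).2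

section ZeroRegionProb

variable [Fintype ι]

open Classical in
/-- The probability that `c` is a `0`-region of a uniformly random set of `m` objects. -/
noncomputable def zeroRegionProb (D : ConfigurationSystem U ι κ b) (m : ℕ) (c : κ) : ℝ :=
  sampleProb m (D.definers c) (D.conflictSet univ c)

theorem zeroRegionProb_two_mul_mul_sq_le (D : ConfigurationSystem U ι κ b) {r : ℕ} (hb : b ≤ r)
    (hr : r < Fintype.card ι) (c : κ) :
    D.zeroRegionProb (2 * r) c * (D.conflictCount univ c * r / Fintype.card ι) ^ 2 ≤
      2 * b.centralBinom * D.zeroRegionProb r c := by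
  classical
  set t : ℝ := D.conflictCount univ c * r / Fintype.card ι
  have hdecay : D.zeroRegionProb (2 * r) c ≤
      b.centralBinom * (D.zeroRegionProb r c * Real.exp (-t)) := by
    refine (sampleProb_two_mul_le (D.definers c) (D.conflictSet univ c)
      ((D.card_definers_le c).trans hb) hr).trans ?_
    refine mul_le_mul_of_nonneg_right ?_
      (mul_nonneg (sampleProb_nonneg _ _ _) (Real.exp_pos _).le)
    exact_mod_cast Nat.centralBinom_strictMono.monotone (D.card_definers_le c)
  have hsq : t ^ 2 ≤ 2 * Real.exp t := by
    have ht : 0 ≤ t := by positivity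
    linarith [Real.quadratic_le_exp_of_nonneg ht]
  have hprob : 0 ≤ D.zeroRegionProb r c := sampleProb_nonneg _ _ _
  calc D.zeroRegionProb (2 * r) c * t ^ 2
      ≤ b.centralBinom * (D.zeroRegionProb r c * Real.exp (-t)) * (2 * Real.exp t) := by gcongr
    _ = 2 * b.centralBinom * D.zeroRegionProb r c * (Real.exp (-t) * Real.exp t) := by ring
    _ = 2 * b.centralBinom * D.zeroRegionProb r c := by
        rw [← Real.exp_add, neg_add_cancel, Real.exp_zero, mul_one]

end ZeroRegionProb

variable [Fintype κ]

theorem mem_regions_zero_iff [Fintype ι] {D : ConfigurationSystem U ι κ b} {H : Finset ι} {c : κ} :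
    c ∈ D.regions 0 H ↔ D.definers c ⊆ H ∧ Disjoint H (D.conflictSet univ c) := by
  classical
  simp only [regions, conflictCount, conflictSet, mem_filter, mem_univ, true_and, card_eq_zero,
    filter_eq_empty_iff, disjoint_left]

theorem IsLikelyNet.mem_cover {D : ConfigurationSystem U ι κ b} {K : ℝ} {q : ℕ} {T R : Finset ι}
    (hR : D.IsLikelyNet K q T R) (hD : D.IsComplete) {p : U} (hp : (#T : ℝ) / q < D.depth T p) :
    p ∈ D.cover R := by
  classical
  by_contra hpR
  obtain ⟨c, hc, hpc⟩ := hD R p hpR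
  obtain ⟨j, hj, hcj⟩ := hR.2.2 c hc
  have hconflict : D.conflictCount T c = j := (mem_filter.1 hcj).2.2
  have hdepth : (D.depth T p : ℝ) ≤ j := by
    exact_mod_cast hconflict ▸ D.depth_le_conflictCount T hpc
  exact (hp.trans_le (hdepth.trans hj)).false

theorem LikelyNetsExist.exists_card_le_sq {D : ConfigurationSystem U ι κ b} {K : ℝ}
    (hK : D.LikelyNetsExist K) (hD : D.IsComplete) (T : Finset ι) {δ : ℝ} (hδ : 0 < δ) (c : κ) :
    ∃ N ⊆ T, (#N : ℝ) ≤ 4 * |K| * (D.conflictCount T c / δ) ^ 2 ∧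
      ∀ p ∈ D.region c, δ ≤ D.depth T p → p ∈ D.cover N := by
  classical
  set t : ℝ := D.conflictCount T c / δ
  rcases lt_or_ge t 1 with ht1 | ht1
  · refine ⟨∅, empty_subset T, by rw [card_empty, Nat.cast_zero]; positivity,
      fun p hp hdeep => absurd hdeep (not_le.2 ?_)⟩
    have hdepth : (D.depth T p : ℝ) ≤ D.conflictCount T c := by
      exact_mod_cast D.depth_le_conflictCount T hp
    exact hdepth.trans_lt ((div_lt_one hδ).1 ht1)
  · set q := ⌊t⌋₊ + 1 with hq
    have hq2 : 2 ≤ q := Nat.succ_le_succ (Nat.one_le_floor_iff t |>.2 ht1)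
    have htq : t < q := by exact_mod_cast Nat.lt_floor_add_one t
    have hqt : (q : ℝ) ≤ 2 * t := by
      have hfloor := Nat.floor_le (zero_le_one.trans ht1)
      rw [hq, Nat.cast_add_one]
      linarith
    obtain ⟨N, hN⟩ := hK (D.conflictSet T c) q hq2
    refine ⟨N, hN.1.trans (filter_subset _ _), hN.2.1.trans ?_,
      fun p hp hdeep => hN.mem_cover hD ?_⟩
    · calc K * q * Real.log q ≤ |K| * q * q := by
            gcongr
            exacts [le_abs_self K, Real.log_le_self q.cast_nonneg]
        _ ≤ |K| * (2 * t) * (2 * t) := by gcongr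
        _ = 4 * |K| * t ^ 2 := by ring
    · rw [D.depth_conflictSet T hp]
      refine lt_of_lt_of_le ?_ hdeep
      rwa [div_lt_comm₀ (by positivity) hδ]

open Classical in
theorem IsComplete.isNet_union_biUnion {D : ConfigurationSystem U ι κ b} (hD : D.IsComplete)
    {ε : ℝ} {T R : Finset ι} {N : κ → Finset ι} (hR : R ⊆ T) (hN : ∀ c ∈ D.regions 0 R, N c ⊆ T)
    (hcover : ∀ c ∈ D.regions 0 R, ∀ p ∈ D.region c, ε * #T ≤ D.depth T p → p ∈ D.cover (N c)) :
    D.IsNet ε T (R ∪ (D.regions 0 R).biUnion N) := by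
  refine ⟨union_subset hR (biUnion_subset.2 hN), fun p hp => ?_⟩
  by_cases hpR : p ∈ D.cover R
  · exact D.cover_mono subset_union_left hpR
  · obtain ⟨c, hc, hpc⟩ := hD R p hpR
    exact D.cover_mono ((subset_biUnion_of_mem N hc).trans subset_union_right)
      (hcover c hc p hpc hp)

variable [Fintype ι]

open Classical in
theorem zeroRegionProb_eq_expect (D : ConfigurationSystem U ι κ b) (m : ℕ) (c : κ) :
    D.zeroRegionProb m c =
      𝔼 R ∈ (univ : Finset ι).powersetCard m, if c ∈ D.regions 0 R then 1 else 0 := by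
  simp only [zeroRegionProb, sampleProb, mem_regions_zero_iff, expect_eq_sum_div_card, sum_boole,
    card_powersetCard, card_univ]

theorem expect_sum_regions_zero (D : ConfigurationSystem U ι κ b) (m : ℕ) (w : κ → ℝ) :
    𝔼 R ∈ (univ : Finset ι).powersetCard m, ∑ c ∈ D.regions 0 R, w c =
      ∑ c, D.zeroRegionProb m c * w c := by
  classical
  calc 𝔼 R ∈ (univ : Finset ι).powersetCard m, ∑ c ∈ D.regions 0 R, w c
      = 𝔼 R ∈ (univ : Finset ι).powersetCard m,
          ∑ c, (if c ∈ D.regions 0 R then 1 else 0) * w c := by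
        simp only [ite_mul, one_mul, zero_mul, sum_ite_mem, univ_inter]
    _ = ∑ c, D.zeroRegionProb m c * w c := by
        simp only [expect_sum_comm, ← expect_mul, zeroRegionProb_eq_expect]

theorem expectedZeroRegions_eq_sum (D : ConfigurationSystem U ι κ b) (m : ℕ) :
    D.expectedZeroRegions m = ∑ c, D.zeroRegionProb m c := by
  simpa only [expectedZeroRegions, expect_eq_sum_div_card, card_eq_sum_ones, Nat.cast_sum,
    Nat.cast_one, mul_one] using D.expect_sum_regions_zero m fun _ => 1

theorem exists_sum_regions_zero_le (D : ConfigurationSystem U ι κ b) {m : ℕ}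
    (hm : m ≤ Fintype.card ι) (w : κ → ℝ) :
    ∃ R : Finset ι, #R = m ∧
      ∑ c ∈ D.regions 0 R, w c ≤ ∑ c, D.zeroRegionProb m c * w c := by
  obtain ⟨R, hR, hle⟩ := exists_le_of_expect_le (powersetCard_nonempty.2 hm)
    (D.expect_sum_regions_zero m w).le
  exact ⟨R, (mem_powersetCard.1 hR).2, hle⟩

theorem sum_zeroRegionProb_two_mul_mul_sq_le (D : ConfigurationSystem U ι κ b) {r : ℕ}
    (hb : b ≤ r) (hr : r < Fintype.card ι) :
    ∑ c, D.zeroRegionProb (2 * r) c * (D.conflictCount univ c * r / Fintype.card ι) ^ 2 ≤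
      2 * b.centralBinom * D.expectedZeroRegions r := by
  rw [expectedZeroRegions_eq_sum, mul_sum]
  exact sum_le_sum fun c _ => D.zeroRegionProb_two_mul_mul_sq_le hb hr c

open Classical in
theorem exists_card_union_biUnion_le (D : ConfigurationSystem U ι κ b) {L : ℝ} (hL : 0 ≤ L) {r : ℕ}
    (hb : b ≤ r) (hr : 1 ≤ r) (hrn : 2 * r ≤ Fintype.card ι) {N : κ → Finset ι}
    (hN : ∀ c, (#(N c) : ℝ) ≤ L * (D.conflictCount univ c * r / Fintype.card ι) ^ 2) :
    ∃ R : Finset ι, (#(R ∪ (D.regions 0 R).biUnion N) : ℝ) ≤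
      2 * r + 2 * L * b.centralBinom * D.expectedZeroRegions r := by
  obtain ⟨R, hR, hRsum⟩ := D.exists_sum_regions_zero_le hrn fun c => (#(N c) : ℝ)
  refine ⟨R, ?_⟩
  calc (#(R ∪ (D.regions 0 R).biUnion N) : ℝ)
      ≤ 2 * r + ∑ c ∈ D.regions 0 R, (#(N c) : ℝ) := by
        have hcard := (card_union_le R ((D.regions 0 R).biUnion N)).trans
          (Nat.add_le_add_left card_biUnion_le _)
        rw [hR] at hcard
        exact_mod_cast hcard
    _ ≤ 2 * r + ∑ c, D.zeroRegionProb (2 * r) c *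
          (L * (D.conflictCount univ c * r / Fintype.card ι) ^ 2) := by
        gcongr
        refine hRsum.trans (sum_le_sum fun c _ => ?_)
        exact mul_le_mul_of_nonneg_left (hN c) (sampleProb_nonneg _ _ _)
    _ = 2 * r + L * ∑ c, D.zeroRegionProb (2 * r) c *
          (D.conflictCount univ c * r / Fintype.card ι) ^ 2 := by
        simp only [mul_sum, mul_left_comm]
    _ ≤ 2 * r + L * (2 * b.centralBinom * D.expectedZeroRegions r) := by
        gcongr
        exact D.sum_zeroRegionProb_two_mul_mul_sq_le hb (by omega)
    _ = 2 * r + 2 * L * b.centralBinom * D.expectedZeroRegions r := by ring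

end ConfigurationSystem

theorem mainTheorem1_general {U ι κ : Type*} [Fintype ι] [Fintype κ] {b : ℕ} {K : ℝ}
    {D : ConfigurationSystem U ι κ b} (hD : D.IsComplete) (hK : D.LikelyNetsExist K) {r : ℕ}
    (hr : 1 ≤ r) (hb : b ≤ r) (hrn : r ≤ Fintype.card ι) :
    ∃ N : Finset ι, D.IsNet (1 / (r : ℝ)) univ N ∧
      (#N : ℝ) ≤ 2 * r + 8 * |K| * b.centralBinom * D.expectedZeroRegions r := by
  classical
  have hr0 : (0 : ℝ) < r := by exact_mod_cast hr
  have hn0 : (0 : ℝ) < Fintype.card ι := by exact_mod_cast hr.trans hrn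
  rcases lt_or_ge (Fintype.card ι) (2 * r) with hsmall | hlarge
  · refine ⟨univ, D.isNet_self (by positivity) (card_pos.1 (hr.trans hrn)), ?_⟩
    have hcard : (#(univ : Finset ι) : ℝ) ≤ 2 * r := by exact_mod_cast hsmall.le
    exact hcard.trans (le_add_of_nonneg_right
      (mul_nonneg (by positivity) (div_nonneg (by positivity) (by positivity))))
  · choose N hNuniv hNcard hNcover using
      hK.exists_card_le_sq hD univ (div_pos hn0 hr0)
    simp only [div_div_eq_mul_div] at hNcard
    obtain ⟨R, hR⟩ := D.exists_card_union_biUnion_le (by positivity) hb hr hlarge hNcard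
    refine ⟨R ∪ (D.regions 0 R).biUnion N,
      hD.isNet_union_biUnion (subset_univ R) (fun c _ => hNuniv c)
        fun c _ p hp hdeep => hNcover c p hp ?_, ?_⟩
    · rwa [card_univ, one_div_mul_eq_div] at hdeep
    · linarith

theorem mainTheorem1 (b : ℕ) (K : ℝ) :
    ∃ C : ℝ, 0 < C ∧
      ∀ (U : Type*) (ι : Type*) (κ : Type*) [Fintype ι] [Fintype κ]
        (D : ConfigurationSystem U ι κ b),
        D.IsComplete → D.LikelyNetsExist K →
        ∀ r : ℕ, 1 ≤ r → 2 * b ≤ r → r ≤ Fintype.card ι →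
          ∃ N : Finset ι, D.IsNet (1 / (r : ℝ)) Finset.univ N ∧
            (N.card : ℝ) ≤ C * max (r : ℝ) (D.expectedZeroRegions r) := by
  refine ⟨2 + 8 * |K| * b.centralBinom, by positivity, ?_⟩
  intro U ι κ _ _ D hD hK r hr hb hrn
  obtain ⟨N, hN, hcard⟩ := mainTheorem1_general hD hK hr (by omega) hrn
  refine ⟨N, hN, hcard.trans ?_⟩
  rw [add_mul]
  gcongr
  exacts [le_max_left _ _, le_max_right _ _]
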